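/- Consider the pull protocol on the complete graph with $n \ge 2$ vertices: at the start exactly one node is informed, and in each round $t = 1, 2, \dots$ every uninformed node calls a node chosen uniformly at random among all $n$ nodes (itself included), independently of all other calls, and becomes informed if the called node was informed at the beginning of the round; informed nodes stay informed. Let $T_n$ be the rumor spreading time, that is, the smallest $t \ge 0$ such that all $n$ nodes are informed at the end of round $t$. Then $\mathbb{E}[T_n]$ is finite and $$\mathbb{E}[T_n] = \log_2 n + \log_2 \ln n \pm O(1),$$ that is, there is an absolute constant $C$ such that $\bigl|\mathbb{E}[T_n] - (\log_2 n + \log_2 \ln n)\bigr| \le C$ for all $n \ge 2$. -/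

import Mathlib

open scoped ENNReal

/-- The set of informed nodes at the end of round `t` of the pull protocol started with the single
informed node `v₀`, where `call t v` is the node called by `v` in round `t + 1`. In each round, every
uninformed node whose call reaches a node that was informed at the start of the round becomes
informed; informed nodes stay informed. -/
def pullInformed {V : Type*} [Fintype V] [DecidableEq V] (v₀ : V) (call : ℕ → V → V) :
    ℕ → Finset V
  | 0 => {v₀}
  | t + 1 => pullInformed v₀ call t ∪
      Finset.univ.filter fun v => v ∉ pullInformed v₀ call t ∧ call t v ∈ pullInformed v₀ call t

/-- The rumor spreading time: the first `t` such that all nodes are informed at the end of round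
`t` (it is `⊤` if this never happens). -/
noncomputable def pullSpreadingTime {V : Type*} [Fintype V] [DecidableEq V] (v₀ : V)
    (call : ℕ → V → V) : ℕ∞ :=
  ⨅ (t : ℕ) (_ : Fintype.card V ≤ (pullInformed v₀ call t).card), (t : ℕ∞)

/-- The law of the calls: the targets of all calls `call t v` (over all rounds `t` and all nodes `v`)
are independent and uniformly distributed over the set of all `n` nodes. -/
noncomputable def pullCallLaw (n : ℕ) [NeZero n] : MeasureTheory.Measure (ℕ → Fin n → Fin n) :=
  MeasureTheory.Measure.infinitePi fun _ : ℕ =>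
    MeasureTheory.Measure.pi fun _ : Fin n => (PMF.uniformOfFintype (Fin n)).toMeasure

/-- The expected rumor spreading time of the pull protocol on the complete graph with vertex set
`Fin n`, started with the informed node `v₀`. -/
noncomputable def pullExpectedTime (n : ℕ) [NeZero n] (v₀ : Fin n) : ℝ≥0∞ :=
  ∫⁻ call, ((pullSpreadingTime v₀ call : ℕ∞) : ℝ≥0∞) ∂(pullCallLaw n)

/-! With `u` nodes uninformed, each of them stays so with probability `u / n`, so the next count is
binomial with parameters `u` and `u / n`. The informed set roughly doubles while small; later the
uninformed fraction is roughly squared, so `log (n / u)` doubles. Either way a logarithmic potential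
moves by about `log 2` per round, and `log 2 * E[T]` is compared with its total change.

Lower bound: `growthPotential` at most doubles in mean (`binomialMean_growthPotential_le`), so by
Jensen its logarithm gains at most `log 2` per round. That logarithm must climb from about `-log n`
to about `log (log n)`.

Upper bound: `remainingPotential` is a sum of three monotone terms, so none of them increases. In
each regime (`n ≤ 3u`, then `3u < n ≤ u²`, then `u² < n`) one of them loses `log 2` in mean
(`binomialMean_remainingPotential_le`).

The drifts are summed against the probabilities that the process is unfinished, whose sum is `E[T]`.
-/

open MeasureTheory ProbabilityTheory

/-! ### Moments and Jensen bounds for the binomial law -/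

/-- The expectation of `F` under the binomial law with parameters `m` and `x`. -/
noncomputable def binomialMean (m : ℕ) (x : ℝ) (F : ℕ → ℝ) : ℝ :=
  ∑ j ∈ Finset.range (m + 1), (m.choose j : ℝ) * x ^ j * (1 - x) ^ (m - j) * F j

lemma binomialMean_mono {m : ℕ} {x : ℝ} (h0 : 0 ≤ x) (h1 : x ≤ 1) {F G : ℕ → ℝ}
    (h : ∀ j ≤ m, F j ≤ G j) : binomialMean m x F ≤ binomialMean m x G := by
  refine Finset.sum_le_sum fun j hj => mul_le_mul_of_nonneg_left
    (h j (Nat.lt_succ_iff.1 (Finset.mem_range.1 hj))) ?_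
  have : 0 ≤ 1 - x := by linarith
  positivity

lemma binomialMean_add (m : ℕ) (x : ℝ) (F G : ℕ → ℝ) :
    binomialMean m x (fun j => F j + G j) = binomialMean m x F + binomialMean m x G := by
  simp only [binomialMean, mul_add, Finset.sum_add_distrib]

lemma binomialMean_const_mul (m : ℕ) (x c : ℝ) (F : ℕ → ℝ) :
    binomialMean m x (fun j => c * F j) = c * binomialMean m x F := by
  simp only [binomialMean, Finset.mul_sum]
  exact Finset.sum_congr rfl fun j _ => by ring

lemma binomialMean_one (m : ℕ) (x : ℝ) : binomialMean m x (fun _ => 1) = 1 := by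
  have h := congrArg (Polynomial.eval x) (bernsteinPolynomial.sum ℝ m)
  simpa [binomialMean, bernsteinPolynomial, Polynomial.eval_finsetSum] using h

lemma binomialMean_const (m : ℕ) (x c : ℝ) : binomialMean m x (fun _ => c) = c := by
  simpa [binomialMean_one] using binomialMean_const_mul m x c fun _ => 1

lemma binomialMean_id (m : ℕ) (x : ℝ) : binomialMean m x (fun j => (j : ℝ)) = m * x := by
  have h := congrArg (Polynomial.eval x) (bernsteinPolynomial.sum_smul ℝ m)
  simp only [bernsteinPolynomial, Polynomial.eval_finsetSum] at h
  simp at h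
  rw [← h, binomialMean]
  exact Finset.sum_congr rfl fun j _ => by ring

lemma binomialMean_variance (m : ℕ) (x : ℝ) :
    binomialMean m x (fun j => (m * x - j) ^ 2) = m * x * (1 - x) := by
  have h := congrArg (Polynomial.eval x) (bernsteinPolynomial.variance ℝ m)
  simp only [bernsteinPolynomial, Polynomial.eval_finsetSum] at h
  simp at h
  rw [← h, binomialMean]
  exact Finset.sum_congr rfl fun j _ => by ring

lemma binomialMean_zero (x : ℝ) (F : ℕ → ℝ) : binomialMean 0 x F = F 0 := by
  simp [binomialMean]

lemma binomialMean_ite_eq_zero (m : ℕ) (x : ℝ) :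
    binomialMean m x (fun j => if j = 0 then 1 else 0) = (1 - x) ^ m := by
  simp [binomialMean]

/-- Since `(m + 1) * C(m, j) = (j + 1) * C(m + 1, j + 1)`, multiplying by `(m + 1) * x` gives the
mass that the binomial law with parameters `m + 1`, `x` puts off `0`. -/
lemma binomialMean_inv_succ_le (m : ℕ) {x : ℝ} (h0 : 0 < x) (h1 : x ≤ 1) :
    binomialMean m x (fun j => 1 / ((j : ℝ) + 1)) ≤ 1 / ((m + 1) * x) := by
  rw [le_div_iff₀ (by positivity)]
  have key : binomialMean m x (fun j => 1 / ((j : ℝ) + 1)) * ((m + 1) * x) =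
      ∑ j ∈ Finset.range (m + 1), ((m + 1).choose (j + 1) : ℝ) * x ^ (j + 1) *
        (1 - x) ^ (m + 1 - (j + 1)) := by
    rw [binomialMean, Finset.sum_mul]
    refine Finset.sum_congr rfl fun j _ => ?_
    have h : ((m : ℝ) + 1) * m.choose j = (m + 1).choose (j + 1) * (j + 1) := by
      exact_mod_cast Nat.add_one_mul_choose_eq m j
    have hj : (j : ℝ) + 1 ≠ 0 := by positivity
    rw [Nat.add_sub_add_right]
    field_simp
    linear_combination (x ^ (j + 1) * (1 - x) ^ (m - j)) * h
  rw [key]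
  have h := binomialMean_one (m + 1) x
  rw [binomialMean, Finset.sum_range_succ'] at h
  simp only [mul_one] at h
  have : (0 : ℝ) ≤ (1 - x) ^ (m + 1) := pow_nonneg (by linarith) _
  simp only [Nat.choose_zero_right, pow_zero, Nat.cast_one, Nat.sub_zero, one_mul] at h
  linarith

/-- Jensen's inequality, via the tangent to `log` at `a`. -/
lemma binomialMean_log_le {m : ℕ} {x : ℝ} (h0 : 0 ≤ x) (h1 : x ≤ 1) {Y : ℕ → ℝ} {a : ℝ}
    (ha : 0 < a) (hY : ∀ j ≤ m, 0 < Y j) (hm : binomialMean m x Y ≤ a) :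
    binomialMean m x (fun j => Real.log (Y j)) ≤ Real.log a := by
  calc binomialMean m x (fun j => Real.log (Y j))
      ≤ binomialMean m x (fun j => (Real.log a - 1) + a⁻¹ * Y j) := by
        refine binomialMean_mono h0 h1 fun j hj => ?_
        have h := Real.log_le_sub_one_of_pos (div_pos (hY j hj) ha)
        rw [Real.log_div (hY j hj).ne' ha.ne', div_eq_inv_mul] at h
        linarith
    _ = (Real.log a - 1) + a⁻¹ * binomialMean m x Y := by
        rw [binomialMean_add, binomialMean_const, binomialMean_const_mul]
    _ ≤ (Real.log a - 1) + a⁻¹ * a := by gcongr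
    _ = Real.log a := by rw [inv_mul_cancel₀ ha.ne']; ring

/-! ### Lower bound: drift of the growth potential -/

/-- A quantity that at most doubles in expectation in each round. -/
noncomputable def growthPotential (n : ℕ) (j : ℕ) : ℝ :=
  Real.log ((n + 1) / (j + 1)) + 2 * (n - j) / n

lemma growthPotential_pos {n j : ℕ} (hj : j < n) : 0 < growthPotential n j := by
  have hj' : (j : ℝ) < n := by exact_mod_cast hj
  have hn : (0 : ℝ) < n := by linarith [(Nat.cast_nonneg j : (0 : ℝ) ≤ j)]
  have h1 : 0 ≤ Real.log (((n : ℝ) + 1) / (j + 1)) :=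
    Real.log_nonneg (by rw [le_div_iff₀ (by positivity)]; linarith)
  have h2 : 0 < 2 * ((n : ℝ) - j) / n := div_pos (by linarith) hn
  unfold growthPotential
  linarith

/-- Jensen and the inverse moment double the logarithmic term up to an error `k / ((n + 1) * u)`,
where `k = n - u`. The linear term has mean `2 * (2k / n) - 2k² / n²`, and its slack `2k² / n²`
absorbs that error. -/
lemma binomialMean_growthPotential_le {n u : ℕ} (hu : 1 ≤ u) (hun : u < n) :
    binomialMean u (u / n) (growthPotential n) ≤ 2 * growthPotential n u := by
  obtain ⟨k, rfl⟩ : ∃ k, n = u + k := ⟨n - u, by omega⟩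
  have hk : (1 : ℝ) ≤ k := by exact_mod_cast (by omega : 1 ≤ k)
  have hu' : (1 : ℝ) ≤ u := by exact_mod_cast hu
  set N : ℝ := ((u + k : ℕ) : ℝ) with hN
  have hNe : N = u + k := by rw [hN]; push_cast; ring
  have hNpos : 0 < N := by linarith
  have hx0 : 0 < (u : ℝ) / N := by positivity
  have hx1 : (u : ℝ) / N ≤ 1 := by rw [div_le_one hNpos]; linarith
  have hlog : binomialMean u (u / N) (fun j => Real.log ((N + 1) / ((j : ℝ) + 1))) ≤
      Real.log ((N + 1) * N / (u * (u + 1))) := by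
    refine binomialMean_log_le hx0.le hx1 (by positivity) (fun j _ => by positivity) ?_
    have := binomialMean_inv_succ_le u hx0 hx1
    calc _ = (N + 1) * binomialMean u (u / N) (fun j => 1 / ((j : ℝ) + 1)) := by
          rw [← binomialMean_const_mul]; simp only [mul_one_div]
      _ ≤ (N + 1) * (1 / ((u + 1) * (u / N))) := by gcongr
      _ = _ := by field_simp
  have hlin : binomialMean u (u / N) (fun j => 2 * (N - (j : ℝ)) / N) = 2 - 2 * u * (u / N) / N := by
    have : (fun j : ℕ => 2 * (N - (j : ℝ)) / N) = fun j : ℕ => 2 + (-2 / N) * (j : ℝ) := by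
      funext j; field_simp; ring
    rw [this, binomialMean_add, binomialMean_const, binomialMean_const_mul, binomialMean_id]
    ring
  have hsplit : Real.log ((N + 1) * N / (u * (u + 1))) =
      2 * Real.log ((N + 1) / (u + 1)) + Real.log (N * (u + 1) / ((N + 1) * u)) := by
    rw [two_mul, ← Real.log_mul (by positivity) (by positivity),
      ← Real.log_mul (by positivity) (by positivity)]
    congr 1
    field_simp
  have hsmall := Real.log_le_sub_one_of_pos (show 0 < N * (u + 1) / ((N + 1) * u) by positivity)
  have hfin : N * (u + 1) / ((N + 1) * u) - 1 ≤ 2 * k ^ 2 / N ^ 2 := by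
    rw [show N * (u + 1) / ((N + 1) * u) - 1 = k / ((N + 1) * u) by
      rw [hNe]; field_simp; ring]
    rw [div_le_div_iff₀ (by positivity) (by positivity), hNe]
    -- Equivalently `u * k ≥ u + k - 1`, which is where both `u ≥ 1` and `k ≥ 1` enter.
    have h1 : 0 ≤ ((u : ℝ) - 1) * (k - 1) := mul_nonneg (by linarith) (by linarith)
    nlinarith [mul_nonneg (by linarith : (0 : ℝ) ≤ k) h1,
      mul_nonneg (mul_nonneg (by linarith : (0 : ℝ) ≤ k) h1) (by linarith : (0 : ℝ) ≤ u + k)]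
  have hexp : binomialMean u (u / N) (growthPotential (u + k)) =
      binomialMean u (u / N) (fun j => Real.log ((N + 1) / ((j : ℝ) + 1))) +
      binomialMean u (u / N) (fun j => 2 * (N - (j : ℝ)) / N) := by
    rw [← binomialMean_add]; rfl
  have hval : 2 - 2 * u * (u / N) / N + 2 * k ^ 2 / N ^ 2 = 2 * (2 * (N - u) / N) := by
    rw [hNe]; field_simp; ring
  rw [hexp, hlin]
  unfold growthPotential
  rw [← hN]
  linarith

lemma binomialMean_log_growthPotential_le {n u : ℕ} (hu : 1 ≤ u) (hun : u < n) :
    binomialMean u (u / n) (fun j => Real.log (growthPotential n j)) ≤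
      Real.log (growthPotential n u) + Real.log 2 := by
  have hn : (0 : ℝ) < n := by exact_mod_cast (by omega : 0 < n)
  have hpos := growthPotential_pos hun
  rw [add_comm, ← Real.log_mul two_ne_zero hpos.ne']
  refine binomialMean_log_le (by positivity) ?_ (by positivity)
    (fun j hj => growthPotential_pos (by omega)) (binomialMean_growthPotential_le hu hun)
  rw [div_le_one hn]
  exact_mod_cast hun.le

/-! ### Upper bound: squaring phase -/

/-- On `[1, ∞)` the function `φ` below is minimal at `t = L`. With `M = log (n / j)` and `L = log (n
/ y)` the exponential becomes `j / y`, so the bound is linear in `j`. -/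
lemma log_sub_log_le_exp_sub {L M : ℝ} (hL : 1 ≤ L) (hM : 1 ≤ M) :
    Real.log L - Real.log M ≤ (Real.exp (L - M) - 1) / L := by
  have hLpos : 0 < L := by linarith
  set φ : ℝ → ℝ := fun t => (Real.exp (L - t) - 1) / L + Real.log t with hφ
  have hder : ∀ t, 1 ≤ t → HasDerivAt φ (-Real.exp (L - t) / L + 1 / t) t := fun t ht => by
    have h1 : HasDerivAt (fun t : ℝ => L - t) (-1) t := by
      simpa using (hasDerivAt_id t).const_sub L
    have h2 := ((h1.exp.sub_const 1).div_const L).add (Real.hasDerivAt_log (by linarith : t ≠ 0))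
    exact h2.congr_deriv (by ring)
  have hcont : ContinuousOn φ (Set.Ici 1) := fun t ht =>
    (hder t ht).continuousAt.continuousWithinAt
  have hval : φ L = Real.log L := by simp [hφ]
  suffices h : φ L ≤ φ M by
    have : φ M = (Real.exp (L - M) - 1) / L + Real.log M := rfl
    linarith
  rcases le_total L M with h | h
  · have hmono : MonotoneOn φ (Set.Ici L) := by
      refine monotoneOn_of_deriv_nonneg (convex_Ici L)
        (hcont.mono (Set.Ici_subset_Ici.2 hL)) ?_ ?_
      · rw [interior_Ici]
        exact fun t ht => (hder t (hL.trans (le_of_lt ht))).differentiableAt.differentiableWithinAt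
      · rw [interior_Ici]
        intro t (ht : L < t)
        have htpos : 0 < t := by linarith
        rw [(hder t (by linarith)).deriv]
        have hexp : t / L ≤ Real.exp (t - L) := by
          have := Real.add_one_le_exp (t - L)
          rw [div_le_iff₀ hLpos]
          nlinarith
        have hinv : Real.exp (L - t) * Real.exp (t - L) = 1 := by
          rw [← Real.exp_add]; simp
        have : Real.exp (L - t) / L ≤ 1 / t := by
          rw [div_le_div_iff₀ hLpos htpos, one_mul]
          rw [div_le_iff₀ hLpos] at hexp
          nlinarith [Real.exp_pos (L - t)]
        rw [neg_div]; linarith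
    exact hmono Set.self_mem_Ici h h
  · have hanti : AntitoneOn φ (Set.Icc 1 L) := by
      refine antitoneOn_of_deriv_nonpos (convex_Icc 1 L)
        (hcont.mono Set.Icc_subset_Ici_self) ?_ ?_
      · rw [interior_Icc]
        exact fun t ht => (hder t (le_of_lt ht.1)).differentiableAt.differentiableWithinAt
      · rw [interior_Icc]
        rintro t ⟨ht1, ht2⟩
        have htpos : 0 < t := by linarith
        rw [(hder t ht1.le).deriv]
        have : 1 / t ≤ Real.exp (L - t) / L := by
          rw [div_le_div_iff₀ htpos hLpos, one_mul]
          have := Real.add_one_le_exp (L - t)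
          nlinarith
        rw [neg_div]; linarith
    exact hanti ⟨hM, h⟩ ⟨hL, le_rfl⟩ h

/-- Controls the number of rounds from `n / 3` down to about `√n` uninformed nodes. -/
noncomputable def endPotential (n j : ℕ) : ℝ :=
  if j = 0 then -Real.log (max 1 (Real.log n)) - 1 else -Real.log (max 1 (Real.log (n / j)))

/-- The right side is the tangent at `j = y` of `-log (log (n / j))`, a majorant although this
function is not concave throughout. The extra `-1` in the value at `j = 0` keeps that point below
the line, since `1 / L ≤ 1`. -/
lemma endPotential_le_tangent {n : ℕ} (j : ℕ) {y : ℝ} (hy : 1 ≤ y)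
    (hL : 1 ≤ Real.log (n / y)) :
    endPotential n j ≤ -Real.log (Real.log (n / y)) + (j / y - 1) / Real.log (n / y) := by
  have hn : (0 : ℝ) < n := by
    rcases Nat.eq_zero_or_pos n with rfl | h
    · norm_num at hL
    · exact_mod_cast h
  set L := Real.log (n / y) with hLdef
  have hLn : L ≤ Real.log n := Real.log_le_log (by positivity) (div_le_self hn.le hy)
  unfold endPotential
  split_ifs with hj
  · subst hj
    rw [max_eq_right (hL.trans hLn)]
    have h1 : Real.log L ≤ Real.log (Real.log n) := Real.log_le_log (by linarith) hLn
    have h2 : 1 / L ≤ 1 := by rw [div_le_one (by linarith)]; exact hL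
    have h3 : ((0 : ℕ) / y - 1) / L = -(1 / L) := by simp [neg_div]
    rw [h3]; linarith
  · have hjpos : (0 : ℝ) < j := by exact_mod_cast Nat.pos_of_ne_zero hj
    have h := log_sub_log_le_exp_sub hL (le_max_left 1 (Real.log (n / j)))
    have hexp : Real.exp (L - max 1 (Real.log (n / j))) ≤ j / y := by
      have : L - Real.log (n / j) = Real.log (j / y) := by
        rw [hLdef, Real.log_div hn.ne' (by positivity), Real.log_div hn.ne' hjpos.ne',
          Real.log_div hjpos.ne' (by positivity)]
        ring
      rw [← Real.exp_log (show 0 < (j : ℝ) / y by positivity), ← this]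
      exact Real.exp_le_exp.2 (sub_le_sub_left (le_max_right _ _) _)
    have : (Real.exp (L - max 1 (Real.log (n / j))) - 1) / L ≤ (j / y - 1) / L := by gcongr
    linarith

lemma endPotential_mono {n i j : ℕ} (hn : 0 < n) (hij : i ≤ j) :
    endPotential n i ≤ endPotential n j := by
  have hn' : (0 : ℝ) < n := by exact_mod_cast hn
  rcases Nat.eq_zero_or_pos j with rfl | hj
  · rw [Nat.le_zero.1 hij]
  have hj1 : (1 : ℝ) ≤ j := by exact_mod_cast hj
  unfold endPotential
  rw [if_neg hj.ne']
  split_ifs with hi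
  · have : Real.log (max 1 (Real.log (n / j))) ≤ Real.log (max 1 (Real.log n)) :=
      Real.log_le_log (by positivity)
        (max_le_max le_rfl (Real.log_le_log (by positivity) (div_le_self hn'.le hj1)))
    linarith
  · have hi0 : (0 : ℝ) < i := by exact_mod_cast Nat.pos_of_ne_zero hi
    have hij' : (i : ℝ) ≤ j := by exact_mod_cast hij
    exact neg_le_neg (Real.log_le_log (by positivity)
      (max_le_max le_rfl (Real.log_le_log (by positivity) (by gcongr))))

lemma endPotential_nonpos (n j : ℕ) : endPotential n j ≤ 0 := by
  have h (x : ℝ) : 0 ≤ Real.log (max 1 x) := Real.log_nonneg (le_max_left _ _)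
  unfold endPotential
  split_ifs
  · linarith [h (Real.log n)]
  · linarith [h (Real.log (n / j))]

/-- The tangent is taken at the mean `y = u² / n`, so its linear part averages to zero. There `n / y
= (n / u)²`, which doubles the inner logarithm. The hypotheses give `y ≥ 1` and, as `e < 3`, `log (n
/ u) ≥ 1`. -/
lemma binomialMean_endPotential_le {n u : ℕ} (hu : 1 ≤ u) (hun : 3 * u < n) (hnu : n ≤ u ^ 2) :
    binomialMean u (u / n) (endPotential n) ≤ endPotential n u - Real.log 2 := by
  have hn : (0 : ℝ) < n := by exact_mod_cast (by omega : 0 < n)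
  have hu0 : (0 : ℝ) < u := by exact_mod_cast hu
  have hun' : 3 * (u : ℝ) < n := by exact_mod_cast hun
  have hlog : 1 ≤ Real.log (n / u) := by
    rw [Real.le_log_iff_exp_le (by positivity), le_div_iff₀ hu0]
    nlinarith [Real.exp_one_lt_d9]
  set y : ℝ := u * (u / n) with hy
  have hy1 : 1 ≤ y := by
    rw [hy, ← mul_div_assoc, le_div_iff₀ hn, one_mul, ← sq]; exact_mod_cast hnu
  have hdbl : Real.log (n / y) = 2 * Real.log (n / u) := by
    rw [show (n : ℝ) / y = (n / u) ^ 2 by rw [hy]; field_simp, Real.log_pow]; norm_num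
  have hL : 1 ≤ Real.log (n / y) := by linarith
  calc binomialMean u (u / n) (endPotential n)
      ≤ binomialMean u (u / n) (fun j => (-Real.log (Real.log (n / y)) - 1 / Real.log (n / y)) +
          (1 / (y * Real.log (n / y))) * (j : ℝ)) := by
        refine binomialMean_mono (by positivity) (by rw [div_le_one hn]; linarith) fun j _ => ?_
        refine (endPotential_le_tangent j hy1 hL).trans_eq ?_
        field_simp
        ring
    _ = -Real.log (Real.log (n / y)) := by
        rw [binomialMean_add, binomialMean_const, binomialMean_const_mul, binomialMean_id, ← hy]
        field_simp
        ring
    _ = endPotential n u - Real.log 2 := by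
        rw [hdbl, Real.log_mul two_ne_zero (by linarith), endPotential, if_neg (by omega),
          max_eq_right hlog]
        ring

/-! ### Upper bound: doubling phase -/

/-- Controls the number of rounds until at most `n / 3` nodes are uninformed. -/
noncomputable def startPotential (n j : ℕ) : ℝ :=
  -Real.log (n - j) + 2 / (n - j) - 3 * (n - j) / n

lemma startPotential_mono {n i j : ℕ} (hij : i ≤ j) (hj : j < n) :
    startPotential n i ≤ startPotential n j := by
  have hj' : (0 : ℝ) < n - j := by rw [sub_pos]; exact_mod_cast hj
  have hij' : (n : ℝ) - j ≤ n - i := sub_le_sub_left (by exact_mod_cast hij) _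
  have hn : (0 : ℝ) ≤ n := Nat.cast_nonneg n
  have h1 := Real.log_le_log hj' hij'
  have h2 : 2 / ((n : ℝ) - i) ≤ 2 / (n - j) := by gcongr
  have h3 : 3 * ((n : ℝ) - j) / n ≤ 3 * (n - i) / n := by gcongr
  unfold startPotential
  linarith

/-- With `k` nodes informed, the next number has mean `k * (2 - q)`, so `-log` loses `log 2` up to
errors in `q` and a variance error of order `s = 1 / k`. The decrease of `-3 * (n - j) / n` pays for
the former, that of `2 / (n - j)` for the latter. -/
lemma binomialMean_startPotential_le {n u : ℕ} (hun : u < n) (hnu : n ≤ 3 * u) :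
    binomialMean u (u / n) (startPotential n) ≤ startPotential n u - Real.log 2 := by
  have hn : (0 : ℝ) < n := by exact_mod_cast (by omega : 0 < n)
  have hu0 : (0 : ℝ) < u := by exact_mod_cast (by omega : 0 < u)
  have hk1 : (1 : ℝ) ≤ n - u := by
    have : (u : ℝ) + 1 ≤ n := by exact_mod_cast hun
    linarith
  have hnu' : (n : ℝ) ≤ 3 * u := by exact_mod_cast hnu
  set k : ℝ := n - u with hk
  have hkpos : 0 < k := by linarith
  have huk : (u : ℝ) = n - k := by rw [hk]; ring
  set q : ℝ := k / n with hq
  set s : ℝ := 1 / k with hs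
  have hq0 : 0 < q := by positivity
  have hq1 : q ≤ 2 / 3 := by rw [hq, div_le_div_iff₀ hn (by norm_num)]; linarith
  have hs0 : 0 < s := by positivity
  have hs1 : s ≤ 1 := by rw [hs, div_le_one hkpos]; exact hk1
  have hx : (u : ℝ) / n = 1 - q := by rw [hq, hk]; field_simp; ring
  set e : ℕ → ℝ := fun j => u * (u / n) - j with he
  have hmean : binomialMean u (u / n) e = 0 := by
    have : e = fun j : ℕ => u * ((u : ℝ) / n) + (-1) * (j : ℝ) := by funext j; simp only [he]; ring
    rw [this, binomialMean_add, binomialMean_const, binomialMean_const_mul, binomialMean_id]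
    ring
  have hvar : binomialMean u (u / n) (fun j => e j ^ 2) = (1 - q) ^ 2 * k := by
    rw [binomialMean_variance, hx, hq, hk]
    have : (u : ℝ) = n * (1 - (n - u) / n) := by field_simp; ring
    nth_rewrite 1 [this]
    field_simp
    ring
  -- A quadratic majorant in the deviation `e j`, so that only mean and variance are needed.
  have hpt : ∀ j ≤ u, startPotential n j ≤
      ((-Real.log (2 * k) + (1 + s) * (q / 2 + q ^ 2 / 2) + s - 3 * (2 * q - q ^ 2)) +
        (-((1 + s) * (1 + 2 * q) * s / 2) - 3 / n) * e j) + ((1 + s) * s ^ 2 / 2) * e j ^ 2 := by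
    intro j hj
    have hjk : k ≤ n - j := sub_le_sub_left (by exact_mod_cast hj) _
    set r : ℝ := (n - j) / (2 * k) with hr
    have hr2 : 1 / 2 ≤ r := by rw [hr, div_le_div_iff₀ (by norm_num) (by positivity)]; linarith
    have hrpos : 0 < r := by linarith
    -- Amounts to `(r - 1)² * (2r - 1) ≥ 0`; here `r ≥ 1 / 2` because informed nodes are never lost.
    have hinv : 1 / r ≤ 1 - (r - 1) + 2 * (r - 1) ^ 2 := by
      rw [div_le_iff₀ hrpos]
      nlinarith [mul_nonneg (sq_nonneg (r - 1)) (by linarith : 0 ≤ 2 * r - 1)]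
    have hnj : (n : ℝ) - j = 2 * k * r := by rw [hr]; field_simp
    have hlog : -Real.log (n - j) ≤ -Real.log (2 * k) + (1 / r - 1) := by
      rw [hnj, Real.log_mul (by positivity) hrpos.ne']
      have := Real.log_le_sub_one_of_pos (inv_pos.2 hrpos)
      rw [Real.log_inv] at this
      rw [one_div]; linarith
    have hdiv : 2 / ((n : ℝ) - j) = s * (1 / r) := by rw [hnj, hs]; field_simp
    have hre : r - 1 = s / 2 * e j - q / 2 := by
      simp only [hr, hs, hq, he]
      rw [huk]
      field_simp
      ring
    have hlin : 3 * ((n : ℝ) - j) / n = 3 * (2 * q - q ^ 2) + 3 / n * e j := by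
      simp only [hq, he]
      rw [huk]
      field_simp
      ring
    have hmul : s * (1 / r) ≤ s * (1 - (r - 1) + 2 * (r - 1) ^ 2) := by gcongr
    rw [hre] at hinv hmul
    unfold startPotential
    rw [hdiv, hlin]
    linear_combination hlog + hinv + hmul
  have hfinal := binomialMean_mono (x := (u : ℝ) / n) (by positivity)
    (by rw [hx]; linarith) hpt
  rw [binomialMean_add, binomialMean_add, binomialMean_const, binomialMean_const_mul,
    binomialMean_const_mul, hmean, hvar] at hfinal
  refine hfinal.trans ?_
  have hsk : s * k = 1 := by rw [hs]; field_simp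
  have h2k : Real.log (2 * k) = Real.log 2 + Real.log k :=
    Real.log_mul two_ne_zero hkpos.ne'
  have hval : startPotential n u = -Real.log k + 2 * s - 3 * q := by
    unfold startPotential
    rw [← hk, hs, hq]
    ring
  rw [hval, h2k]
  have hvs : (1 + s) * s ^ 2 / 2 * ((1 - q) ^ 2 * k) = (1 + s) * s / 2 * (1 - q) ^ 2 := by
    linear_combination ((1 + s) * s / 2 * (1 - q) ^ 2) * hsk
  rw [hvs]
  -- The total slack is the sum of these three terms; `q ≤ 2 / 3` makes the first nonnegative, `s ≤
  -- 1` the third.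
  have e1 : 0 ≤ q * (5 / 2 - 7 / 2 * q) := mul_nonneg hq0.le (by linarith)
  have e2 : 0 ≤ s * (3 / 2 * q - 3 / 2 * q ^ 2) :=
    mul_nonneg hs0.le (by nlinarith)
  have e3 : 0 ≤ s * ((1 - s) * ((1 - q) ^ 2 / 2)) :=
    mul_nonneg hs0.le (mul_nonneg (by linarith) (by positivity))
  linear_combination e1 + e2 + e3

/-! ### Upper bound: combined potential -/

/-- Bounds, up to the factor `log 2`, the expected number of remaining rounds when `j` of `n` nodes
are uninformed. -/
noncomputable def remainingPotential (n j : ℕ) : ℝ :=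
  (startPotential n j + endPotential n j) + (8 + (-8) * if j = 0 then 1 else 0)

lemma remainingPotential_mono {n i j : ℕ} (hij : i ≤ j) (hj : j < n) :
    remainingPotential n i ≤ remainingPotential n j := by
  have h1 := startPotential_mono hij hj
  have h2 := endPotential_mono (by omega : 0 < n) hij
  unfold remainingPotential
  split_ifs <;> first | omega | linarith

/-- With at most `√n` nodes uninformed, the round finishes the process with probability at least
`e⁻²`: use `1 - x ≥ exp (-2x)` for `x ≤ 1 / 2`. -/
lemma exp_neg_two_le_pow {n u : ℕ} (hun : u < n) (hnu : u ^ 2 ≤ n) (hn : 2 ≤ n) :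
    Real.exp (-2) ≤ (1 - (u : ℝ) / n) ^ u := by
  have hn0 : (0 : ℝ) < n := by exact_mod_cast (by omega : 0 < n)
  set x : ℝ := (u : ℝ) / n with hx
  have hx0 : 0 ≤ x := by positivity
  have hx2 : x ≤ 1 / 2 := by
    have : 2 * u ≤ n := by
      rcases Nat.lt_or_ge u 2 with h | h <;> nlinarith
    rw [hx, div_le_div_iff₀ hn0 (by norm_num)]
    have : (2 : ℝ) * u ≤ n := by exact_mod_cast this
    linarith
  have hxu : x * u ≤ 1 := by
    rw [hx, div_mul_eq_mul_div, div_le_one hn0, ← sq]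
    exact_mod_cast hnu
  have h1 : Real.exp (-(2 * x)) ≤ 1 - x := by
    have h2 := Real.add_one_le_exp (2 * x)
    have h3 : Real.exp (-(2 * x)) * Real.exp (2 * x) = 1 := by rw [← Real.exp_add]; simp
    nlinarith [Real.exp_pos (-(2 * x))]
  calc Real.exp (-2) ≤ Real.exp (u * -(2 * x)) := Real.exp_le_exp.2 (by linarith)
    _ = Real.exp (-(2 * x)) ^ u := Real.exp_nat_mul _ _
    _ ≤ _ := by gcongr

/-- Shows that the weight `8` of the indicator in `remainingPotential` is large enough for the last
regime. -/
lemma log_two_le_eight_mul_exp_neg_two : Real.log 2 ≤ 8 * Real.exp (-2) := by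
  have h1 := Real.exp_one_lt_d9
  have h2 : Real.exp 2 = Real.exp 1 * Real.exp 1 := by rw [← Real.exp_add]; norm_num
  have h3 := Real.log_two_lt_d9
  have h4 : Real.exp (-2) * Real.exp 2 = 1 := by rw [← Real.exp_add]; simp
  have h5 : Real.exp 2 ≤ 7.39 := by rw [h2]; nlinarith [Real.exp_pos 1]
  nlinarith [Real.exp_pos (-2)]

lemma binomialMean_remainingPotential_le {n u : ℕ} (hu : 1 ≤ u) (hun : u < n) :
    binomialMean u (u / n) (remainingPotential n) ≤ remainingPotential n u - Real.log 2 := by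
  have hn0 : (0 : ℝ) < n := by exact_mod_cast (by omega : 0 < n)
  have hx0 : (0 : ℝ) ≤ u / n := by positivity
  have hx1 : (u : ℝ) / n ≤ 1 := by rw [div_le_one hn0]; exact_mod_cast hun.le
  have hsplit : binomialMean u (u / n) (remainingPotential n) =
      (binomialMean u (u / n) (startPotential n) + binomialMean u (u / n) (endPotential n)) +
        (8 + (-8) * (1 - (u : ℝ) / n) ^ u) := by
    rw [← binomialMean_ite_eq_zero, ← binomialMean_const_mul,
      ← binomialMean_const u ((u : ℝ) / n) 8, ← binomialMean_add, ← binomialMean_add,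
      ← binomialMean_add, binomialMean_const]
    rfl
  have hval : remainingPotential n u = startPotential n u + endPotential n u + 8 := by
    rw [remainingPotential, if_neg (by omega)]
    ring
  have hS : binomialMean u (u / n) (startPotential n) ≤ startPotential n u := by
    simpa [binomialMean_const] using binomialMean_mono (G := fun _ => startPotential n u) hx0 hx1
      fun j hj => startPotential_mono hj hun
  have hE : binomialMean u (u / n) (endPotential n) ≤ endPotential n u := by
    simpa [binomialMean_const] using binomialMean_mono (G := fun _ => endPotential n u) hx0 hx1
      fun j hj => endPotential_mono (by omega : 0 < n) hj
  have hP : 0 ≤ (1 - (u : ℝ) / n) ^ u := pow_nonneg (by linarith) _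
  rw [hsplit, hval]
  rcases le_or_gt n (3 * u) with h3 | h3
  · have := binomialMean_startPotential_le hun h3
    linarith
  rcases le_or_gt n (u ^ 2) with h2 | h2
  · have := binomialMean_endPotential_le hu h3 h2
    linarith
  · have := exp_neg_two_le_pow hun h2.le (by omega)
    have := log_two_le_eight_mul_exp_neg_two
    linarith

/-! ### One round: the uninformed count is binomial -/

/-- These call vectors form a product set: nodes of `A` call freely, nodes of `S` call into `Aᶜ`,
all others into `A`. -/
lemma card_filter_pull_eq {V : Type*} [Fintype V] [DecidableEq V] (A S : Finset V) (hS : S ⊆ Aᶜ) :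
    (Finset.univ.filter fun c : V → V =>
      (Finset.univ.filter fun v => v ∉ A ∧ c v ∉ A) = S).card =
      Fintype.card V ^ A.card * (Aᶜ.card ^ S.card * A.card ^ (Aᶜ.card - S.card)) := by
  have h : (Finset.univ.filter fun c : V → V =>
      (Finset.univ.filter fun v => v ∉ A ∧ c v ∉ A) = S) =
      Fintype.piFinset fun v => if v ∈ A then Finset.univ else if v ∈ S then Aᶜ else A := by
    ext c
    simp only [Finset.mem_filter, Finset.mem_univ, true_and, Fintype.mem_piFinset,
      Finset.ext_iff]
    refine forall_congr' fun v => ?_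
    by_cases hA : v ∈ A
    · have : v ∉ S := fun h => by simpa [hA] using hS h
      simp [hA, this]
    · by_cases hv : v ∈ S <;> simp [hA, hv]
  rw [h, Fintype.card_piFinset, ← Finset.prod_mul_prod_compl A, ← Finset.prod_sdiff hS]
  have h1 : ∏ v ∈ A, (if v ∈ A then Finset.univ else if v ∈ S then Aᶜ else A : Finset V).card =
      Fintype.card V ^ A.card :=
    Finset.prod_eq_pow_card fun v hv => by simp [hv]
  have h2 : ∏ v ∈ S, (if v ∈ A then Finset.univ else if v ∈ S then Aᶜ else A : Finset V).card =
      Aᶜ.card ^ S.card :=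
    Finset.prod_eq_pow_card fun v hv => by
      have : v ∉ A := by simpa using hS hv
      simp [hv, this]
  have h3 : ∏ v ∈ Aᶜ \ S,
      (if v ∈ A then Finset.univ else if v ∈ S then Aᶜ else A : Finset V).card =
      A.card ^ (Aᶜ.card - S.card) := by
    rw [← Finset.card_sdiff_of_subset hS]
    exact Finset.prod_eq_pow_card fun v hv => by
      simp only [Finset.mem_sdiff, Finset.mem_compl] at hv
      simp [hv.1, hv.2]
  rw [h1, h2, h3]
  ring

lemma sum_card_filter_pull_eq {n : ℕ} (hn : 0 < n) (A : Finset (Fin n)) (F : ℕ → ℝ) :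
    ∑ c : Fin n → Fin n, F (Finset.univ.filter fun v => v ∉ A ∧ c v ∉ A).card =
      (n : ℝ) ^ n * binomialMean Aᶜ.card (Aᶜ.card / n) F := by
  have hn0 : (n : ℝ) ≠ 0 := by positivity
  have hcard : A.card + Aᶜ.card = n := by simp
  have hA : (A.card : ℝ) / n = 1 - Aᶜ.card / n := by
    have : (A.card : ℝ) + Aᶜ.card = n := by exact_mod_cast hcard
    field_simp
    linarith
  rw [← Finset.sum_fiberwise_of_maps_to
    (g := fun c : Fin n → Fin n => Finset.univ.filter fun v => v ∉ A ∧ c v ∉ A)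
    (t := Aᶜ.powerset) (fun c _ => by
      rw [Finset.mem_powerset]
      intro v hv
      simp only [Finset.mem_filter] at hv
      simpa using hv.2.1)]
  have h : ∀ S ∈ Aᶜ.powerset, ∑ c : Fin n → Fin n with (Finset.univ.filter fun v => v ∉ A ∧ c v ∉ A) = S,
      F (Finset.univ.filter fun v => v ∉ A ∧ c v ∉ A).card =
      (n : ℝ) ^ A.card * ((Aᶜ.card : ℝ) ^ S.card * (A.card : ℝ) ^ (Aᶜ.card - S.card)) *
        F S.card := by
    intro S hS
    rw [Finset.sum_congr rfl (g := fun _ => F S.card)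
      (fun c hc => by rw [(Finset.mem_filter.1 hc).2]), Finset.sum_const,
      card_filter_pull_eq A S (Finset.mem_powerset.1 hS)]
    simp
  rw [Finset.sum_congr rfl h, Finset.sum_powerset_apply_card (fun m => (n : ℝ) ^ A.card *
    ((Aᶜ.card : ℝ) ^ m * (A.card : ℝ) ^ (Aᶜ.card - m)) * F m), binomialMean, Finset.mul_sum]
  refine Finset.sum_congr rfl fun j hj => ?_
  have hj' : j ≤ Aᶜ.card := Nat.lt_succ_iff.1 (Finset.mem_range.1 hj)
  rw [← hA, nsmul_eq_mul, div_pow, div_pow]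
  have hp : (n : ℝ) ^ n = (n : ℝ) ^ A.card * ((n : ℝ) ^ j * (n : ℝ) ^ (Aᶜ.card - j)) := by
    rw [← pow_add, ← pow_add]
    congr 1
    omega
  rw [hp]
  field_simp

/-! ### Trajectories and the spreading time -/

lemma compl_pullInformed_succ {V : Type*} [Fintype V] [DecidableEq V] (v₀ : V) (call : ℕ → V → V)
    (t : ℕ) : (pullInformed v₀ call (t + 1))ᶜ = Finset.univ.filter fun v =>
      v ∉ pullInformed v₀ call t ∧ call t v ∉ pullInformed v₀ call t := by
  ext v
  simp only [pullInformed, Finset.mem_compl, Finset.mem_union, Finset.mem_filter,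
    Finset.mem_univ, true_and]
  tauto

lemma pullInformed_congr {V : Type*} [Fintype V] [DecidableEq V] (v₀ : V) {call call' : ℕ → V → V}
    (t : ℕ) (h : ∀ s < t, call s = call' s) :
    pullInformed v₀ call t = pullInformed v₀ call' t := by
  induction t with
  | zero => rfl
  | succ t ih =>
    simp only [pullInformed, ih fun s hs => h s (hs.trans t.lt_succ_self), h t t.lt_succ_self]

/-- The number of uninformed nodes at the end of round `t`. -/
def pullUninformed {V : Type*} [Fintype V] [DecidableEq V] (v₀ : V) (call : ℕ → V → V)
    (t : ℕ) : ℕ := (pullInformed v₀ call t)ᶜ.card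

lemma pullUninformed_lt {V : Type*} [Fintype V] [DecidableEq V] (v₀ : V) (call : ℕ → V → V)
    (t : ℕ) : pullUninformed v₀ call t < Fintype.card V := by
  have h : v₀ ∈ pullInformed v₀ call t := by
    induction t with
    | zero => simp [pullInformed]
    | succ t ih => exact Finset.mem_union_left _ ih
  exact Finset.card_lt_univ_of_notMem (x := v₀) (by simpa using h)

lemma pullUninformed_antitone {V : Type*} [Fintype V] [DecidableEq V] (v₀ : V)
    (call : ℕ → V → V) : Antitone (pullUninformed v₀ call) :=
  antitone_nat_of_succ_le fun _ =>
    Finset.card_le_card (Finset.compl_subset_compl.2 Finset.subset_union_left)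

/-- By monotonicity the unfinished times are exactly those before the spreading time; if the process
never finishes, both sides are infinite. -/
lemma pullSpreadingTime_eq_tsum {V : Type*} [Fintype V] [DecidableEq V] (v₀ : V)
    (call : ℕ → V → V) : ((pullSpreadingTime v₀ call : ℕ∞) : ℝ≥0∞) =
      ∑' t, if pullUninformed v₀ call t = 0 then 0 else 1 := by
  have hiff : ∀ t, Fintype.card V ≤ (pullInformed v₀ call t).card ↔
      pullUninformed v₀ call t = 0 := fun t => by
    rw [pullUninformed, Finset.card_compl, Nat.sub_eq_zero_iff_le]
  simp only [pullSpreadingTime, hiff]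
  by_cases h : ∃ t, pullUninformed v₀ call t = 0
  · have hm : ∀ t, pullUninformed v₀ call t = 0 ↔ Nat.find h ≤ t := fun t =>
      ⟨fun ht => Nat.find_min' h ht, fun ht => Nat.le_zero.1
        ((pullUninformed_antitone v₀ call ht).trans_eq (Nat.find_spec h))⟩
    have hT : (⨅ (t : ℕ) (_ : pullUninformed v₀ call t = 0), (t : ℕ∞)) = (Nat.find h : ℕ∞) :=
      le_antisymm (iInf₂_le (Nat.find h) (Nat.find_spec h))
        (le_iInf₂ fun _ ht => by exact_mod_cast (hm _).1 ht)
    rw [hT, tsum_eq_sum (s := Finset.range (Nat.find h))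
      (fun t ht => if_pos ((hm t).2 (by simpa using ht))),
      Finset.sum_congr rfl (g := fun _ => (1 : ℝ≥0∞)) (fun t ht => if_neg (by
        rw [hm, not_le]; exact Finset.mem_range.1 ht))]
    simp
  · push Not at h
    simp [h]

/-- Extends finitely many rounds of calls to all rounds. -/
def extendCalls {n : ℕ} (t : ℕ) (r : Finset.range t → Fin n → Fin n) (s : ℕ) : Fin n → Fin n :=
  if h : s ∈ Finset.range t then r ⟨s, h⟩ else fun v => v

/-- The state after `t` rounds never reads the filler calls. It is therefore a function on a finite
type, which settles measurability, and depends only on calls independent of `call t`. -/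
lemma pullInformed_extendCalls {n : ℕ} (v₀ : Fin n) (t : ℕ) (call : ℕ → Fin n → Fin n) :
    pullInformed v₀ (extendCalls t fun s => call s) t = pullInformed v₀ call t :=
  pullInformed_congr v₀ t fun s hs => by simp [extendCalls, hs]

lemma measurable_pullUninformed {n : ℕ} (v₀ : Fin n) (t : ℕ) :
    Measurable fun call : ℕ → Fin n → Fin n => pullUninformed v₀ call t := by
  have h : (fun call : ℕ → Fin n → Fin n => pullUninformed v₀ call t) =
      (fun r => (pullInformed v₀ (extendCalls t r) t)ᶜ.card) ∘
        fun call (s : Finset.range t) => call s := by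
    funext call
    simp only [Function.comp_apply, pullUninformed]
    rw [pullInformed_extendCalls]
  rw [h]
  exact (measurable_of_finite _).comp (by fun_prop)

/-! ### Markov property and summed drift -/

section law

variable {n : ℕ} [NeZero n]

instance : IsProbabilityMeasure (pullCallLaw n) := by
  unfold pullCallLaw; infer_instance

lemma integral_pi_uniform (f : (Fin n → Fin n) → ℝ) :
    ∫ c, f c ∂(Measure.pi fun _ : Fin n => (PMF.uniformOfFintype (Fin n)).toMeasure) =
      ((n : ℝ) ^ n)⁻¹ * ∑ c, f c := by
  rw [integral_fintype .of_finite, Finset.mul_sum]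
  refine Finset.sum_congr rfl fun c _ => ?_
  rw [measureReal_def, Measure.pi_singleton]
  simp

/-- The Markov property: the first `t` rounds `X` are independent of the next round `Y`, and Fubini
reduces the inner integral to the one-round count. -/
lemma integral_pullUninformed_succ (v₀ : Fin n) (F : ℕ → ℝ) (t : ℕ) :
    ∫ call, F (pullUninformed v₀ call (t + 1)) ∂(pullCallLaw n) =
      ∫ call, binomialMean (pullUninformed v₀ call t) (pullUninformed v₀ call t / n) F
        ∂(pullCallLaw n) := by
  set X : (ℕ → Fin n → Fin n) → (Finset.range t → Fin n → Fin n) := fun call s => call s with hX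
  set Y : (ℕ → Fin n → Fin n) → (Fin n → Fin n) := fun call => call t with hY
  have hXm : Measurable X := by fun_prop
  have hYm : Measurable Y := by fun_prop
  have hind : IndepFun X Y (pullCallLaw n) := by
    have h := (iIndepFun_infinitePi (P := fun _ : ℕ =>
      Measure.pi fun _ : Fin n => (PMF.uniformOfFintype (Fin n)).toMeasure)
      (X := fun _ ω => ω) (fun _ => measurable_id)).indepFun_finset (Finset.range t) {t}
      (by simp) (fun i => by fun_prop)
    have hψ : Measurable fun f : ({t} : Finset ℕ) → Fin n → Fin n => f ⟨t, by simp⟩ :=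
      measurable_pi_apply _
    exact h.comp measurable_id hψ
  set ν := Measure.pi fun _ : Fin n => (PMF.uniformOfFintype (Fin n)).toMeasure
  have hmapY : (pullCallLaw n).map Y = ν := Measure.infinitePi_map_eval _ t
  have hprod := (indepFun_iff_map_prod_eq_prod_map_map hXm.aemeasurable hYm.aemeasurable).1 hind
  rw [hmapY] at hprod
  have : IsProbabilityMeasure ((pullCallLaw n).map X) :=
    Measure.isProbabilityMeasure_map hXm.aemeasurable
  set A : (Finset.range t → Fin n → Fin n) → Finset (Fin n) :=
    fun r => pullInformed v₀ (extendCalls t r) t with hA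
  have hAX : ∀ call, A (X call) = pullInformed v₀ call t := pullInformed_extendCalls v₀ t
  set G : (Finset.range t → Fin n → Fin n) × (Fin n → Fin n) → ℝ := fun p =>
    F (Finset.univ.filter fun v => v ∉ A p.1 ∧ p.2 v ∉ A p.1).card with hG
  calc ∫ call, F (pullUninformed v₀ call (t + 1)) ∂(pullCallLaw n)
      = ∫ call, G (X call, Y call) ∂(pullCallLaw n) := by
        simp only [hG, hAX, pullUninformed, compl_pullInformed_succ, hY]
    _ = ∫ p, G p ∂(((pullCallLaw n).map X).prod ν) := by
        rw [← hprod, integral_map (hXm.prodMk hYm).aemeasurable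
          (measurable_of_finite G).aestronglyMeasurable]
    _ = ∫ r, binomialMean (A r)ᶜ.card ((A r)ᶜ.card / n) F ∂((pullCallLaw n).map X) := by
        rw [integral_prod _ .of_finite]
        refine integral_congr_ae (.of_forall fun r => ?_)
        simp only [hG]
        rw [integral_pi_uniform, sum_card_filter_pull_eq (NeZero.pos n) (A r) F,
          inv_mul_cancel_left₀ (pow_ne_zero _ (NeZero.ne _))]
    _ = _ := by
        rw [integral_map hXm.aemeasurable (measurable_of_finite _).aestronglyMeasurable]
        simp only [hAX, pullUninformed]

lemma integrable_pullUninformed (v₀ : Fin n) (F : ℕ → ℝ) (t : ℕ) :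
    Integrable (fun call => F (pullUninformed v₀ call t)) (pullCallLaw n) := by
  refine Integrable.of_bound ((measurable_from_nat (f := F)).comp
    (measurable_pullUninformed v₀ t)).aestronglyMeasurable (∑ j ∈ Finset.range n, ‖F j‖)
    (.of_forall fun call => ?_)
  exact Finset.single_le_sum (f := fun j => ‖F j‖) (fun _ _ => norm_nonneg _)
    (Finset.mem_range.2 (by simpa using pullUninformed_lt v₀ call t))

/-- The probability that some node is uninformed at the end of round `t`. -/
noncomputable def pullUnfinishedProb (v₀ : Fin n) (t : ℕ) : ℝ :=
  ∫ call, (if pullUninformed v₀ call t = 0 then 0 else 1) ∂(pullCallLaw n)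

lemma pullUnfinishedProb_nonneg (v₀ : Fin n) (t : ℕ) : 0 ≤ pullUnfinishedProb v₀ t :=
  integral_nonneg fun _ => by dsimp only; split_ifs <;> norm_num

lemma pullExpectedTime_eq_tsum (v₀ : Fin n) :
    pullExpectedTime n v₀ = ∑' t, ENNReal.ofReal (pullUnfinishedProb v₀ t) := by
  unfold pullExpectedTime
  simp only [pullSpreadingTime_eq_tsum]
  rw [lintegral_tsum fun t => by
    exact ((measurable_from_nat (f := fun j => if j = 0 then (0 : ℝ≥0∞) else 1)).comp
      (measurable_pullUninformed v₀ t)).aemeasurable]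
  refine tsum_congr fun t => ?_
  rw [pullUnfinishedProb, ofReal_integral_eq_lintegral_ofReal
    (integrable_pullUninformed v₀ (fun j => if j = 0 then 0 else 1) t)
    (.of_forall fun _ => by dsimp only; split_ifs <;> norm_num)]
  refine lintegral_congr fun call => ?_
  split_ifs <;> simp

/-- Integrating a pointwise drift bound. -/
lemma integral_pullUninformed_succ_le (v₀ : Fin n) {F : ℕ → ℝ} {δ : ℝ}
    (h : ∀ u, 1 ≤ u → u < n → binomialMean u (u / n) F ≤ F u + δ) (t : ℕ) :
    ∫ call, F (pullUninformed v₀ call (t + 1)) ∂(pullCallLaw n) ≤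
      ∫ call, F (pullUninformed v₀ call t) ∂(pullCallLaw n) + δ * pullUnfinishedProb v₀ t := by
  have hI := integrable_pullUninformed v₀ (fun j => if j = 0 then (0 : ℝ) else 1) t
  rw [integral_pullUninformed_succ, pullUnfinishedProb, ← integral_const_mul,
    ← integral_add (integrable_pullUninformed v₀ F t) (hI.const_mul δ)]
  refine integral_mono (integrable_pullUninformed v₀ (fun u => binomialMean u (u / n) F) t)
    ((integrable_pullUninformed v₀ F t).add (hI.const_mul δ)) fun call => ?_
  have hlt : pullUninformed v₀ call t < n := by simpa using pullUninformed_lt v₀ call t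
  dsimp only
  -- The state `0` is absorbing, so no drift is charged there.
  split_ifs with h0
  · simp [h0, binomialMean_zero]
  · simpa using h _ (Nat.one_le_iff_ne_zero.2 h0) hlt

lemma integral_pullUninformed_le (v₀ : Fin n) {F : ℕ → ℝ} {δ : ℝ}
    (h : ∀ u, 1 ≤ u → u < n → binomialMean u (u / n) F ≤ F u + δ) (N : ℕ) :
    ∫ call, F (pullUninformed v₀ call N) ∂(pullCallLaw n) ≤
      F (n - 1) + δ * ∑ t ∈ Finset.range N, pullUnfinishedProb v₀ t := by
  induction N with
  | zero =>
    have : ∀ call, pullUninformed v₀ call 0 = n - 1 := fun call => by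
      simp [pullUninformed, pullInformed, Finset.card_compl]
    simp [this]
  | succ N ih =>
    have := integral_pullUninformed_succ_le v₀ h N
    rw [Finset.sum_range_succ, mul_add]
    linarith

end law

/-! ### Bounds on the expected time -/

lemma log_two_mul_sum_pullUnfinishedProb_le {n : ℕ} [NeZero n] (hn : 2 ≤ n) (v₀ : Fin n)
    (N : ℕ) : Real.log 2 * ∑ t ∈ Finset.range N, pullUnfinishedProb v₀ t ≤
      Real.log n + Real.log (max 1 (Real.log n)) + 14 := by
  have hn0 : (0 : ℝ) < n := by exact_mod_cast (by omega : 0 < n)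
  have h := integral_pullUninformed_le v₀ (F := remainingPotential n) (δ := -Real.log 2)
    (fun u hu hun => by simpa [sub_eq_add_neg] using binomialMean_remainingPotential_le hu hun) N
  have hlow : remainingPotential n 0 ≤
      ∫ call, remainingPotential n (pullUninformed v₀ call N) ∂(pullCallLaw n) := by
    have := integral_mono (integrable_const (remainingPotential n 0))
      (integrable_pullUninformed v₀ (remainingPotential n) N)
      (fun call => remainingPotential_mono (Nat.zero_le _)
        (by simpa using pullUninformed_lt v₀ call N))
    simpa using this
  -- The `10` is `2` from `2 / (n - j)` at one informed node plus the indicator weight `8`.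
  have hstart : remainingPotential n (n - 1) ≤ 10 := by
    have h1 := endPotential_nonpos n (n - 1)
    have h2 : ((n - 1 : ℕ) : ℝ) = n - 1 := by rw [Nat.cast_sub (by omega)]; simp
    have h3 : startPotential n (n - 1) = 2 - 3 / n := by
      simp [startPotential, h2]
    have h4 : 0 ≤ 3 / (n : ℝ) := by positivity
    rw [remainingPotential, if_neg (by omega)]
    linarith
  -- The `4` is `3` from the linear term plus the extra `1` of `endPotential n 0`.
  have hend : -Real.log n - Real.log (max 1 (Real.log n)) - 4 ≤ remainingPotential n 0 := by
    have h1 : 3 * (n : ℝ) / n = 3 := by field_simp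
    have h2 : 0 ≤ 2 / (n : ℝ) := by positivity
    simp only [remainingPotential, startPotential, endPotential, if_true, Nat.cast_zero, sub_zero,
      h1]
    linarith
  linarith

lemma summable_pullUnfinishedProb {n : ℕ} [NeZero n] (hn : 2 ≤ n) (v₀ : Fin n) :
    Summable (pullUnfinishedProb v₀) :=
  summable_of_sum_range_le (c := (Real.log n + Real.log (max 1 (Real.log n)) + 14) / Real.log 2)
    (pullUnfinishedProb_nonneg v₀) fun N => by
      rw [le_div_iff₀ (Real.log_pos one_lt_two), mul_comm]
      exact log_two_mul_sum_pullUnfinishedProb_le hn v₀ N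

lemma log_two_mul_tsum_pullUnfinishedProb_le {n : ℕ} [NeZero n] (hn : 2 ≤ n) (v₀ : Fin n) :
    Real.log 2 * ∑' t, pullUnfinishedProb v₀ t ≤
      Real.log n + Real.log (max 1 (Real.log n)) + 14 :=
  le_of_tendsto' ((summable_pullUnfinishedProb hn v₀).hasSum.tendsto_sum_nat.const_mul _)
    fun N => log_two_mul_sum_pullUnfinishedProb_le hn v₀ N

/-- After `N` rounds the mean of `F` differs from its terminal value `F 0` only through unfinished
runs, at a cost of at most `M` times their probability. This vanishes in the limit by the
summability that the upper bound provides. -/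
lemma log_growthPotential_sub_le {n : ℕ} [NeZero n] (hn : 2 ≤ n) (v₀ : Fin n) :
    Real.log (growthPotential n 0) - Real.log (growthPotential n (n - 1)) ≤
      Real.log 2 * ∑' t, pullUnfinishedProb v₀ t := by
  set F : ℕ → ℝ := fun j => Real.log (growthPotential n j) with hF
  set M : ℝ := ∑ j ∈ Finset.range n, |F 0 - F j| with hM
  have hsum := summable_pullUnfinishedProb hn v₀
  have hN : ∀ N, F 0 - F (n - 1) - M * pullUnfinishedProb v₀ N ≤
      Real.log 2 * ∑ t ∈ Finset.range N, pullUnfinishedProb v₀ t := by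
    intro N
    have h := integral_pullUninformed_le v₀ (F := F) (δ := Real.log 2)
      (fun u hu hun => binomialMean_log_growthPotential_le hu hun) N
    have hI := (integrable_pullUninformed v₀ (fun j => if j = 0 then (0 : ℝ) else 1) N).const_mul M
    have hlow : F 0 - M * pullUnfinishedProb v₀ N ≤
        ∫ call, F (pullUninformed v₀ call N) ∂(pullCallLaw n) := by
      have hc : ∫ _, F 0 ∂(pullCallLaw n) = F 0 := by simp
      rw [pullUnfinishedProb, ← integral_const_mul, ← hc, ← integral_sub (integrable_const _) hI]
      refine integral_mono ((integrable_const _).sub hI) (integrable_pullUninformed v₀ F N)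
        fun call => ?_
      have hlt : pullUninformed v₀ call N < n := by simpa using pullUninformed_lt v₀ call N
      dsimp only
      split_ifs with h0
      · simp [h0]
      · have h1 := Finset.single_le_sum (f := fun j => |F 0 - F j|) (fun _ _ => abs_nonneg _)
          (Finset.mem_range.2 hlt)
        have h2 := le_abs_self (F 0 - F (pullUninformed v₀ call N))
        linarith
    linarith
  have h1 := (hsum.tendsto_atTop_zero.const_mul M).const_sub (F 0 - F (n - 1))
  rw [mul_zero, sub_zero] at h1
  exact le_of_tendsto_of_tendsto' h1 (hsum.hasSum.tendsto_sum_nat.const_mul _) hN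

theorem mainTheorem6 :
    ∃ C : ℝ, ∀ (n : ℕ) [NeZero n], 2 ≤ n → ∀ v₀ : Fin n,
      pullExpectedTime n v₀ ≠ ∞ ∧
      |(pullExpectedTime n v₀).toReal - (Real.logb 2 n + Real.logb 2 (Real.log n))| ≤ C := by
  -- The upper bound costs `14`, plus `1` for replacing `max 1 (log n)` by `log n`; the lower bound
  -- costs only `2`.
  refine ⟨15 / Real.log 2, fun n _ hn v₀ => ?_⟩
  have hsum := summable_pullUnfinishedProb hn v₀
  have hE : pullExpectedTime n v₀ = ENNReal.ofReal (∑' t, pullUnfinishedProb v₀ t) := by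
    rw [pullExpectedTime_eq_tsum,
      ENNReal.ofReal_tsum_of_nonneg (pullUnfinishedProb_nonneg v₀) hsum]
  refine ⟨by rw [hE]; exact ENNReal.ofReal_ne_top, ?_⟩
  rw [hE, ENNReal.toReal_ofReal (tsum_nonneg (pullUnfinishedProb_nonneg v₀))]
  have hn0 : (0 : ℝ) < n := by exact_mod_cast (by omega : 0 < n)
  have hn2 : (2 : ℝ) ≤ n := by exact_mod_cast hn
  have hl2 : 0 < Real.log 2 := Real.log_pos one_lt_two
  have hl2n : Real.log 2 ≤ Real.log n := Real.log_le_log two_pos hn2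
  have hln : 0 < Real.log n := by linarith
  have hup := log_two_mul_tsum_pullUnfinishedProb_le hn v₀
  have hlow := log_growthPotential_sub_le hn v₀
  have hmax : Real.log (max 1 (Real.log n)) ≤ Real.log (Real.log n) + 1 := by
    -- Uses `e * log 2 > 1`, which covers `n = 2`, where `log n < 1`.
    have h : max 1 (Real.log n) ≤ Real.log n * Real.exp 1 := by
      have h1 := Real.exp_one_gt_d9
      have h2 := Real.log_two_gt_d9
      refine max_le ?_ ?_ <;> nlinarith
    calc _ ≤ Real.log (Real.log n * Real.exp 1) := Real.log_le_log (by positivity) h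
      _ = _ := by rw [Real.log_mul hln.ne' (Real.exp_pos 1).ne', Real.log_exp]
  have hfirst : Real.log (growthPotential n (n - 1)) ≤ 2 - Real.log n := by
    have hpos := growthPotential_pos (by omega : n - 1 < n)
    have hle : growthPotential n (n - 1) ≤ 3 / n := by
      have h2 : ((n - 1 : ℕ) : ℝ) = n - 1 := by rw [Nat.cast_sub (by omega)]; simp
      have h3 := Real.log_le_sub_one_of_pos (show 0 < ((n : ℝ) + 1) / n by positivity)
      have h4 : ((n : ℝ) + 1) / n - 1 = 1 / n := by field_simp; ring
      have h5 : (3 : ℝ) / n = 1 / n + 2 / n := by ring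
      simp only [growthPotential, h2, sub_add_cancel, sub_sub_cancel, mul_one]
      linarith
    have h := Real.log_le_log hpos hle
    rw [Real.log_div (by norm_num) hn0.ne'] at h
    have h3 := Real.log_le_sub_one_of_pos (show (0 : ℝ) < 3 by norm_num)
    linarith
  have hlast : Real.log (Real.log n) ≤ Real.log (growthPotential n 0) := by
    refine Real.log_le_log hln ?_
    have h1 : Real.log n ≤ Real.log ((n + 1) / ((0 : ℕ) + 1)) :=
      Real.log_le_log hn0 (by simp)
    have h2 : 0 ≤ 2 * ((n : ℝ) - (0 : ℕ)) / n := by simp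
    unfold growthPotential
    linarith
  rw [show Real.logb 2 n + Real.logb 2 (Real.log n) =
    (Real.log n + Real.log (Real.log n)) / Real.log 2 by rw [Real.logb, Real.logb]; ring]
  set E : ℝ := ∑' t, pullUnfinishedProb v₀ t
  have hEE : E = Real.log 2 * E / Real.log 2 := by field_simp
  rw [hEE, ← sub_div, abs_div, abs_of_pos hl2]
  gcongr
  rw [abs_le]
  constructor <;> linarith
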